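/- Let $n,k$ be integers with $1\le k\le n-1$, write $[n]=\{1,\dots,n\}$, and for $S\subseteq[n]$ let $e_j(S)=\sum_{T\subseteq S,\,|T|=j}\prod_{i\in T}x_i$, $e_j(\mathbf x)=e_j([n])$, and $q_j(S)=e_j(S)/e_{j-1}(S)$ for $j\ge1$. Let $G_{n,k}$ be the graph whose vertices are two distinguished vertices $s$ and $z$ together with all words $w_1\cdots w_\ell$, $1\le \ell\le k$, with pairwise distinct letters $w_i\in[n]$; its edges join (1) $s$ and each one-letter word $i\in[n]$, (2) $w_1\cdots w_{i-1}$ and $w_1\cdots w_{i-1}w_i$ for $2\le i\le k$, (3) $w_1\cdots w_k$ and $z$. Let $T_{G_{n,k}}=\sum_T\prod_{e\in T}x_e$ be its spanning tree polynomial, the sum being over all spanning trees $T$ (as sets of edges) of $G_{n,k}$. For $r\ge k$ let $H_{k,r}(\mathbf x)\in\mathbb R(x_1,\dots,x_n)$ be obtained from $T_{G_{n,k}}$ by substituting for the edge variables: $r!\,x_i$ for the edges (1), $(r-i+1)!\,x_{w_i}$ for the edges (2), and $(r-k+1)!\,q_{r-k+1}([n]\setminus\{w_1,\dots,w_k\})$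 for the edges (3). Then for $r=k$ every substituted value is a linear form in $x_1,\dots,x_n$, so that the polynomial $H_{k,k}(\mathbf x)$ is obtained from $T_{G_{n,k}}$ by a linear substitution of the edge variables, and there is a constant $C_k>0$ (which may depend on $n$ and $k$) such that $$H_{k,k}(\mathbf x)=C_k\,e_{k+1}(\mathbf x)\prod_{S\subseteq[n],\ |S|\le k-1}\bigl(\partial^S e_k(\mathbf x)\bigr)^{|S|!\,(n-|S|-1)},\qquad \partial^S=\prod_{j\in S}\frac{\partial}{\partial x_j}.$$ -/

import Mathlib

open scoped Nat

noncomputable section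

/-- The spanning tree polynomial of a finite graph `G`: one variable for every edge, and the sum of
the monomials `∏ e ∈ T, x_e` over all sets `T` of edges of `G` that form a spanning tree. -/
def spanningTreePolynomial {V : Type*} [Fintype V] (G : SimpleGraph V) :
    MvPolynomial G.edgeSet ℝ := by
  classical
  exact ∑ T : Finset G.edgeSet with
      (SimpleGraph.fromEdgeSet (Subtype.val '' (T : Set G.edgeSet))).IsTree,
    ∏ e ∈ T, MvPolynomial.X e

/-- Words of length at most `k` with pairwise distinct letters in `[n]`.
The alphabet `[n]` is represented by `Fin n`. -/
abbrev DWord (n k : ℕ) : Type := {w : List (Fin n) // w.Nodup ∧ w.length ≤ k}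

/-- The vertices of `G_{n,k}`. The vertex `z` is `none`. The vertex `s` is the empty word, and the
other vertices are the nonempty words of length at most `k` without repeated letters. -/
abbrev GVertex (n k : ℕ) : Type := Option (DWord n k)

instance (n k : ℕ) : Fintype (DWord n k) :=
  haveI : Finite (DWord n k) :=
    Finite.of_injective (β := {w : List (Fin n) // w.Nodup}) (fun w => ⟨w.1, w.2.1⟩)
      (fun _ _ h => Subtype.ext (congrArg (fun t => t.1) h))
  Fintype.ofFinite _

/-- Adjacency in `G_{n,k}`: each word (`s` being the empty one) is joined to its extensions by one
letter, and each word of length exactly `k` is joined to `z`. -/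
def GAdj (n k : ℕ) : GVertex n k → GVertex n k → Prop
  | none, none => False
  | none, some w => w.1.length = k
  | some w, none => w.1.length = k
  | some u, some v => (∃ a, v.1 = u.1 ++ [a]) ∨ (∃ a, u.1 = v.1 ++ [a])

/-- The graph `G_{n,k}`. -/
def GGraph (n k : ℕ) : SimpleGraph (GVertex n k) where
  Adj := GAdj n k
  symm := ⟨by
    rintro (_ | u) (_ | v) h
    · exact h
    · exact h
    · exact h
    · exact Or.symm h⟩
  loopless := ⟨by
    rintro (_ | u) h
    · exact h
    · rcases h with ⟨a, h⟩ | ⟨a, h⟩ <;> simp at h⟩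

/-- The field `ℝ(x_1, …, x_n)` of rational functions. -/
abbrev RatFun (n : ℕ) : Type := FractionRing (MvPolynomial (Fin n) ℝ)

/-- The elementary symmetric polynomial `e_j(S)` in the variables with index in `S`. -/
def esymmOn {n : ℕ} (j : ℕ) (S : Finset (Fin n)) : MvPolynomial (Fin n) ℝ :=
  ∑ T ∈ S.powersetCard j, ∏ i ∈ T, MvPolynomial.X i

/-- The rational function `q_j(S) = e_j(S) / e_{j-1}(S)`, for `j ≥ 1`. -/
def qRat {n : ℕ} (j : ℕ) (S : Finset (Fin n)) : RatFun n :=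
  algebraMap (MvPolynomial (Fin n) ℝ) (RatFun n) (esymmOn j S) /
    algebraMap (MvPolynomial (Fin n) ℝ) (RatFun n) (esymmOn (j - 1) S)

/-- The value `(r - i + 1)! x_{w_i}` for the edge between `w_1 ⋯ w_{i-1}` and
`w = w_1 ⋯ w_i`, where `i ≥ 1`. -/
def letterVar {n : ℕ} (r : ℕ) (w : List (Fin n)) : RatFun n :=
  match w.getLast? with
  | none => 0
  | some a => ((r - w.length + 1)! : RatFun n) *
      algebraMap (MvPolynomial (Fin n) ℝ) (RatFun n) (MvPolynomial.X a)

/-- The value `(r - k + 1)! q_{r-k+1}([n] \ {w_1, …, w_k})` for the edge between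
`w = w_1 ⋯ w_k` and `z`. -/
def terminalVar {n : ℕ} (k r : ℕ) (w : List (Fin n)) : RatFun n :=
  ((r - k + 1)! : RatFun n) * qRat (r - k + 1) (w.toFinset)ᶜ

/-- The value given to the variable of the edge with end points `u` and `v`. For an edge between
two words, it is read off from the longer one. Only the values at edges of `G_{n,k}` matter. -/
def endpointVar (n k r : ℕ) : GVertex n k → GVertex n k → RatFun n
  | none, none => 0
  | none, some w => terminalVar k r w.1
  | some w, none => terminalVar k r w.1
  | some u, some v =>
      if u.1.length < v.1.length then letterVar r v.1
      else if v.1.length < u.1.length then letterVar r u.1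
      else 0

theorem endpointVar_comm (n k r : ℕ) (u v : GVertex n k) :
    endpointVar n k r u v = endpointVar n k r v u := by
  rcases u with _ | u <;> rcases v with _ | v <;> simp only [endpointVar]
  split_ifs <;> first | rfl | omega

/-- The value given to the variable of an edge of `G_{n,k}` in the definition of `H_{k,r}`. -/
def edgeValue (n k r : ℕ) (e : (GGraph n k).edgeSet) : RatFun n :=
  Sym2.lift ⟨endpointVar n k r, endpointVar_comm n k r⟩ e.1

/-- The rational function `H_{k,r}`, for `k ≤ r`: the spanning tree polynomial of `G_{n,k}`
with `edgeValue n k r e` substituted for the variable of each edge `e`. -/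
def HRat (n k r : ℕ) : RatFun n :=
  MvPolynomial.aeval (edgeValue n k r) (spanningTreePolynomial (GGraph n k))

theorem pderiv_toLinearMap_commute {n : ℕ} (i j : Fin n) :
    Commute ((MvPolynomial.pderiv i : Derivation ℝ (MvPolynomial (Fin n) ℝ) _) :
        Module.End ℝ (MvPolynomial (Fin n) ℝ))
      ((MvPolynomial.pderiv j : Derivation ℝ (MvPolynomial (Fin n) ℝ) _) :
        Module.End ℝ (MvPolynomial (Fin n) ℝ)) := by
  have h : ⁅(MvPolynomial.pderiv i : Derivation ℝ (MvPolynomial (Fin n) ℝ) _),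
      (MvPolynomial.pderiv j : Derivation ℝ (MvPolynomial (Fin n) ℝ) _)⁆ = 0 := by
    apply MvPolynomial.derivation_ext
    intro l
    rw [Derivation.commutator_apply]
    simp only [MvPolynomial.pderiv_X, Derivation.coe_zero, Pi.zero_apply]
    by_cases hi : i = l <;> by_cases hj : j = l <;> simp [hi, hj, eq_comm]
  refine LinearMap.ext fun p => ?_
  have h2 := congrArg (fun D => D p) h
  simp only [Derivation.commutator_apply, Derivation.coe_zero, Pi.zero_apply] at h2
  exact sub_eq_zero.mp h2

/-- The differential operator `∂^S = ∏_{j ∈ S} ∂/∂x_j`. -/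
def partialSet {n : ℕ} (S : Finset (Fin n)) : Module.End ℝ (MvPolynomial (Fin n) ℝ) :=
  S.noncommProd (fun j => ((MvPolynomial.pderiv j : Derivation ℝ (MvPolynomial (Fin n) ℝ) _) :
    Module.End ℝ (MvPolynomial (Fin n) ℝ))) (fun i _ j _ _ => pderiv_toLinearMap_commute i j)

end

/-!
By the matrix-tree theorem, `HRat n k r` is the determinant of the Laplacian of `G_{n,k}` with the
row and the column of `z` removed. Removing `z` leaves the tree of words, so Gaussian elimination
from the longest words upwards creates no new entries: the pivot at a word `v` is the conductance
of the edge from `v` to its parent plus the effective conductance between `v` and `z` through the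
extensions of `v`, which the series and parallel laws compute recursively.

This recursion has the closed solution `(r - |v| + 1)! q_{r-|v|+1}([n] ∖ v)`. Since
`e_{r-|v|}([n] ∖ v) = ∂^v e_r`, the recursion becomes Euler's identity for the homogeneous
polynomial `∂^v e_{r+1}`, and linearity of `∂^u e_r` in the variable `x_a` turns the pivot at
`v = ua` into `(r - |v| + 1)! ∂^u e_r / ∂^v e_r`; at the empty word it is `(r + 1)! e_{r+1} / e_r`.

In the product of the pivots, each word `u` with `|u| < k` contributes `∂^u e_r` once to the
denominator and once to the numerator for each of its `n - |u|` children. As `|S|!` words have `S`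
as their set of letters, `∂^S e_r` is left with the exponent `|S|! (n - |S| - 1)`. The words of
length `k` contribute to the denominator only, by factors that are equal to `1` if `r = k`.
-/

section RootedTree

variable {W : Type*} {f g : W → Option W}

/-- `u` is the parent of `v` in the rooted tree on `Option W` encoded by `f`. The parent of `v` is
the root if `f v = none`; the root itself is never related to anything. -/
def IsParent (f : W → Option W) (u v : W) : Prop := f v = some u

/-- The map `f`, sending each vertex of `Option W` but `none` to its parent, encodes a tree rooted
at `none`: passing from a vertex to its parent cannot be repeated indefinitely. -/
def IsRootedTree (f : W → Option W) : Prop := WellFounded (IsParent f)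

theorem acc_isParent_of_eq_none {v : W} (h : f v = none) : Acc (IsParent f) v :=
  ⟨v, fun u hu => by simp [IsParent, h] at hu⟩

theorem acc_isParent_iff_of_eq_some {u v : W} (h : f v = some u) :
    Acc (IsParent f) v ↔ Acc (IsParent f) u := by
  refine ⟨fun hv => hv.inv h, fun hu => ⟨v, fun u' hu' => ?_⟩⟩
  obtain rfl := Option.some.inj (h.symm.trans hu')
  exact hu

/-- The undirected edge joining `v` to its parent. -/
def parentEdge (f : W → Option W) (v : W) : Sym2 (Option W) := s(some v, f v)

namespace IsRootedTree

theorem apply_ne_self (hf : IsRootedTree f) (v : W) : f v ≠ some v := fun h =>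
  hf.asymmetric v v h h

theorem parentEdge_injective (hf : IsRootedTree f) : Function.Injective (parentEdge f) := by
  intro v u h
  rcases Sym2.eq_iff.1 h with ⟨huv, -⟩ | ⟨hvu, huv⟩
  · exact Option.some.inj huv
  · exact absurd hvu.symm (hf.asymmetric u v huv)

theorem not_isDiag_parentEdge (hf : IsRootedTree f) (v : W) : ¬ (parentEdge f v).IsDiag :=
  fun h => hf.apply_ne_self v (Sym2.mk_isDiag_iff.1 h).symm

theorem eq_of_range_parentEdge_subset (hf : IsRootedTree f)
    (h : Set.range (parentEdge f) ⊆ Set.range (parentEdge g)) : f = g := by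
  funext v
  induction v using hf.induction with
  | _ v ih =>
    obtain ⟨u, hu⟩ := h ⟨v, rfl⟩
    rcases Sym2.eq_iff.1 hu with ⟨huv, hgf⟩ | ⟨huv, hgu⟩
    · rw [← hgf, Option.some.inj huv]
    · have hfu : f u = some v := (ih u huv.symm).trans hgu
      exact absurd hfu (hf.asymmetric u v huv.symm)

theorem isTree_fromEdgeSet [Finite W] (hf : IsRootedTree f) :
    (SimpleGraph.fromEdgeSet (Set.range (parentEdge f))).IsTree := by
  set T := SimpleGraph.fromEdgeSet (Set.range (parentEdge f)) with hT
  have adj_parent (v : W) : T.Adj (some v) (f v) :=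
    (SimpleGraph.fromEdgeSet_adj _).2 ⟨⟨v, rfl⟩, (hf.apply_ne_self v).symm⟩
  have reachable_root (v : W) : T.Reachable (some v) none := by
    induction v using hf.induction with
    | _ v ih =>
      rcases hv : f v with _ | u
      · exact (hv ▸ adj_parent v).reachable
      · exact (hv ▸ adj_parent v).reachable.trans (ih u hv)
  have reachable_root' : ∀ o, T.Reachable o none
    | none => .refl _
    | some v => reachable_root v
  have edgeSet_eq : T.edgeSet = Set.range (parentEdge f) := by
    rw [hT, SimpleGraph.edgeSet_fromEdgeSet, sdiff_eq_left, Set.disjoint_left]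
    rintro _ ⟨v, rfl⟩
    exact hf.not_isDiag_parentEdge v
  rw [SimpleGraph.isTree_iff_connected_and_card]
  refine ⟨⟨fun a b => (reachable_root' a).trans (reachable_root' b).symm⟩, ?_⟩
  rw [edgeSet_eq, Nat.card_range_of_injective hf.parentEdge_injective, Finite.card_option]

end IsRootedTree

theorem exists_isRootedTree_of_isTree [Finite W] {T : SimpleGraph (Option W)} (hT : T.IsTree) :
    ∃ f : W → Option W, IsRootedTree f ∧ Set.range (parentEdge f) = T.edgeSet := by
  have exists_closer (v : W) : ∃ o, T.Adj (some v) o ∧ T.dist o none < T.dist (some v) none := by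
    obtain ⟨p, hp⟩ := hT.connected.exists_walk_length_eq_dist (some v) none
    cases p with
    | cons h q =>
      refine ⟨_, h, ?_⟩
      rw [← hp, SimpleGraph.Walk.length_cons]
      exact Nat.lt_succ_of_le (SimpleGraph.dist_le q)
  choose f hadj hdist using exists_closer
  have hf : IsRootedTree f := by
    refine Subrelation.wf ?_ (measure fun v => T.dist (some v) none).wf
    intro u v (h : f v = some u)
    exact show T.dist (some u) none < _ from h ▸ hdist v
  refine ⟨f, hf, Set.eq_of_subset_of_ncard_le ?_ ?_ (Set.toFinite _)⟩
  · rintro _ ⟨v, rfl⟩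
    exact hadj v
  · have hcard := (SimpleGraph.isTree_iff_connected_and_card.1 hT).2
    rw [Finite.card_option, Nat.add_right_cancel_iff] at hcard
    rw [← Nat.card_coe_set_eq, ← Nat.card_coe_set_eq, hcard,
      Nat.card_range_of_injective hf.parentEdge_injective]

end RootedTree

section MatrixTree

open Matrix

variable {W : Type*} [DecidableEq W] {R : Type*} [CommRing R]

/-- The weighted adjacency matrix of the digraph with an arc of weight `a v` from each `v` to its
parent `f v`, the arcs into the root `none` being left out. -/
def parentMatrix (f : W → Option W) (a : W → R) : Matrix W W R :=
  of fun v u => if f v = some u then a v else 0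

/-- The Laplacian of the digraph on `Option W` in which the arc from `v` to `o` has weight `w v o`,
with the row and the column of `none` removed. -/
def reducedLaplacian [Fintype W] (w : W → Option W → R) : Matrix W W R :=
  diagonal (fun v => ∑ o, w v o) - of fun v u => w v (some u)

variable [Fintype W]

theorem det_one_sub_parentMatrix_of_isRootedTree {f : W → Option W} (hf : IsRootedTree f)
    (a : W → R) : (1 - parentMatrix f a).det = 1 := by
  have eq_zero_of_not_isParent {u v : W} (h : ¬ IsParent f u v) : parentMatrix f a v u = 0 :=
    if_neg h
  let depth (v : W) : Ordinal := (hf.apply v).rank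
  have hM : (1 - parentMatrix f a).BlockTriangular (OrderDual.toDual ∘ depth) := by
    refine blockTriangular_one.sub fun v u (hvu : depth v < depth u) =>
      eq_zero_of_not_isParent fun h => ?_
    exact hvu.not_gt ((hf.apply v).rank_lt_of_rel h)
  have block_eq_one (d) :
      (1 - parentMatrix f a).toSquareBlock (OrderDual.toDual ∘ depth) d = 1 := by
    ext v u
    have hvu : depth v.1 = depth u.1 := OrderDual.toDual.injective (v.2.trans u.2.symm)
    have hzero : parentMatrix f a v.1 u.1 = 0 := eq_zero_of_not_isParent fun h =>
      hvu.not_gt ((hf.apply v.1).rank_lt_of_rel h)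
    simp [toSquareBlock_def, hzero, one_apply, Subtype.ext_iff]
  rw [hM.det, Finset.prod_eq_one fun d _ => by rw [block_eq_one, det_one]]

theorem det_eq_zero_of_mulVec_eq_zero {M : Matrix W W R} {x : W → R} (hx : M *ᵥ x = 0) {v : W}
    (hv : x v = 1) : M.det = 0 := by
  have h : M.det • x = 0 := by
    rw [← one_mulVec x, ← smul_mulVec, ← adjugate_mul, ← mulVec_mulVec, hx, mulVec_zero]
  simpa [hv] using congrFun h v

theorem det_one_sub_parentMatrix_of_not_isRootedTree {f : W → Option W} (hf : ¬ IsRootedTree f) :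
    (1 - parentMatrix f 1 : Matrix W W R).det = 0 := by
  classical
  obtain ⟨v₀, hv₀⟩ : ∃ v, ¬ Acc (IsParent f) v := not_forall.1 fun h => hf ⟨h⟩
  -- The indicator of the vertices from which the root is not reached is a kernel vector.
  refine det_eq_zero_of_mulVec_eq_zero (x := fun v => if Acc (IsParent f) v then 0 else 1) ?_
    (if_neg hv₀)
  rw [sub_mulVec, one_mulVec, sub_eq_zero]
  funext v
  rcases hv : f v with _ | u
  · simp [mulVec, dotProduct, parentMatrix, hv, acc_isParent_of_eq_none hv]
  · simp only [acc_isParent_iff_of_eq_some hv, mulVec, dotProduct, parentMatrix, of_apply, hv,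
      Option.some.injEq, Pi.one_apply, ite_mul, one_mul, zero_mul, Finset.sum_ite_eq,
      Finset.mem_univ, if_true]

open Classical in
theorem det_reducedLaplacian (w : W → Option W → R) :
    (reducedLaplacian w).det = ∑ f : W → Option W with IsRootedTree f, ∏ v, w v (f v) := by
  -- The row of `v` is a combination of rows that each depend on one value `f v` only.
  have row_eq : reducedLaplacian w =
      fun v => ∑ o, w v o • (1 - parentMatrix (fun _ => o) 1 : Matrix W W R) v := by
    funext v u
    simp [reducedLaplacian, parentMatrix, diagonal_apply, one_apply, mul_sub]
  have det_eq_sum : (reducedLaplacian w).det =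
      ∑ f : W → Option W, (∏ v, w v (f v)) * (1 - parentMatrix f 1 : Matrix W W R).det := by
    rw [row_eq]
    refine (detRowAlternating.toMultilinearMap.map_sum fun v o =>
      w v o • (1 - parentMatrix (fun _ => o) 1 : Matrix W W R) v).trans ?_
    exact Finset.sum_congr rfl fun f _ => MultilinearMap.map_smul_univ _ _ _
  rw [det_eq_sum, Finset.sum_filter]
  refine Finset.sum_congr rfl fun f _ => ?_
  split_ifs with hf
  · rw [det_one_sub_parentMatrix_of_isRootedTree hf, mul_one]
  · rw [det_one_sub_parentMatrix_of_not_isRootedTree hf, mul_zero]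

end MatrixTree

section SpanningTrees

variable {W : Type*} [Fintype W] {G : SimpleGraph (Option W)} {f : W → Option W}

open Classical in
/-- The coercions in `spanningTreePolynomial` are elaborated so that its sum runs over the image of
`Finset.univ` in `Set G.edgeSet`; here it is turned into a sum over finsets. -/
theorem spanningTreePolynomial_eq_sum_finset {V : Type*} [Fintype V] (G : SimpleGraph V) :
    spanningTreePolynomial G = ∑ T ∈ (Finset.univ : Finset (Finset G.edgeSet)).filter
        (fun T : Finset G.edgeSet =>
          (SimpleGraph.fromEdgeSet (Subtype.val '' (T : Set G.edgeSet))).IsTree),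
      ∏ e ∈ T, MvPolynomial.X e := by
  unfold spanningTreePolynomial
  have image_eq : (Finset.univ >>= fun T : Finset G.edgeSet => pure (SetLike.coe T)) =
      Finset.univ.image (SetLike.coe : Finset G.edgeSet → Set G.edgeSet) := by
    ext
    simp
  rw [image_eq, Finset.filter_image, Finset.sum_image Finset.coe_injective.injOn]
  exact Finset.sum_congr rfl fun T _ => by rw [Finset.toFinset_coe]

open Classical in
/-- The edges of `G` that join a vertex to its parent. -/
noncomputable def parentEdges (G : SimpleGraph (Option W)) (f : W → Option W) : Finset G.edgeSet :=
  {e | e.1 ∈ Set.range (parentEdge f)}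

theorem image_val_parentEdges (hfG : ∀ v, G.Adj (some v) (f v)) :
    Subtype.val '' (parentEdges G f : Set G.edgeSet) = Set.range (parentEdge f) := by
  ext e
  simp only [parentEdges, Finset.coe_filter, Finset.mem_univ, true_and, Set.mem_image,
    Set.mem_ofPred_eq, Subtype.exists, exists_and_left, exists_prop, exists_eq_right_right,
    and_iff_left_iff_imp]
  rintro ⟨v, rfl⟩
  exact hfG v

theorem exists_parentEdges_eq {T : Finset G.edgeSet}
    (hT : (SimpleGraph.fromEdgeSet (Subtype.val '' (T : Set G.edgeSet))).IsTree) :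
    ∃ f : W → Option W, IsRootedTree f ∧ (∀ v, G.Adj (some v) (f v)) ∧ parentEdges G f = T := by
  obtain ⟨f, hf, hfT⟩ := exists_isRootedTree_of_isTree hT
  have range_eq : Set.range (parentEdge f) = Subtype.val '' (T : Set G.edgeSet) := by
    rw [hfT, SimpleGraph.edgeSet_fromEdgeSet, sdiff_eq_left, Set.disjoint_left]
    rintro _ ⟨e, -, rfl⟩
    exact G.not_isDiag_of_mem_edgeSet e.2
  have hfG (v : W) : G.Adj (some v) (f v) := by
    obtain ⟨e, -, he⟩ := range_eq ▸ Set.mem_range_self v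
    exact (he ▸ e.2 : parentEdge f v ∈ G.edgeSet)
  refine ⟨f, hf, hfG, Finset.coe_injective (Subtype.val_injective.image_injective ?_)⟩
  rw [image_val_parentEdges hfG, range_eq]

variable {A : Type*} [CommRing A]

open Classical in
/-- The weights on pairs of vertices given by a weight `x` on the edges of `G`. -/
noncomputable def edgeWeight (G : SimpleGraph (Option W)) (x : G.edgeSet → A) (v : W)
    (o : Option W) : A :=
  if h : G.Adj (some v) o then x ⟨s(some v, o), h⟩ else 0

theorem prod_parentEdges (x : G.edgeSet → A) (hf : IsRootedTree f)
    (hfG : ∀ v, G.Adj (some v) (f v)) :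
    ∏ e ∈ parentEdges G f, x e = ∏ v, edgeWeight G x v (f v) := by
  classical
  symm
  refine Finset.prod_bij (fun v _ => ⟨parentEdge f v, hfG v⟩) ?_ ?_ ?_ ?_
  · exact fun v _ => (Finset.mem_filter_univ _).2 ⟨v, rfl⟩
  · exact fun v _ u _ h => hf.parentEdge_injective (congrArg Subtype.val h)
  · intro e he
    obtain ⟨v, hv⟩ := (Finset.mem_filter_univ _).1 he
    exact ⟨v, Finset.mem_univ v, Subtype.ext hv⟩
  · exact fun v _ => dif_pos (hfG v)

open Classical in
theorem aeval_spanningTreePolynomial_eq_sum [Algebra ℝ A] (x : G.edgeSet → A) :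
    MvPolynomial.aeval x (spanningTreePolynomial G) =
      ∑ f : W → Option W with IsRootedTree f, ∏ v, edgeWeight G x v (f v) := by
  have sum_subordinate : ∑ f : W → Option W with IsRootedTree f, ∏ v, edgeWeight G x v (f v) =
      ∑ f : W → Option W with IsRootedTree f ∧ ∀ v, G.Adj (some v) (f v),
        ∏ v, edgeWeight G x v (f v) := by
    rw [← Finset.filter_filter]
    refine (Finset.sum_filter_of_ne fun f _ hne v => ?_).symm
    by_contra hv
    exact hne (Finset.prod_eq_zero (Finset.mem_univ v) (dif_neg hv))
  rw [sum_subordinate, spanningTreePolynomial_eq_sum_finset]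
  simp only [map_sum, map_prod, MvPolynomial.aeval_X]
  symm
  refine Finset.sum_nbij (parentEdges G) ?_ ?_ ?_ ?_
  · simp only [Finset.mem_filter, Finset.mem_univ, true_and]
    rintro f ⟨hf, hfG⟩
    rw [image_val_parentEdges hfG]
    exact hf.isTree_fromEdgeSet
  · simp only [Set.InjOn, Finset.coe_filter, Finset.mem_univ, true_and, Set.mem_ofPred_eq]
    rintro f ⟨hf, hfG⟩ g ⟨-, hgG⟩ h
    refine hf.eq_of_range_parentEdge_subset ?_
    rw [← image_val_parentEdges hfG, h, image_val_parentEdges hgG]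
  · intro T hT
    obtain ⟨f, hf, hfG, rfl⟩ := exists_parentEdges_eq (Finset.mem_filter.1 hT).2
    exact ⟨f, by simpa using ⟨hf, hfG⟩, rfl⟩
  · simp only [Finset.mem_filter, Finset.mem_univ, true_and]
    rintro f ⟨hf, hfG⟩
    exact (prod_parentEdges x hf hfG).symm

theorem aeval_spanningTreePolynomial_eq_det [DecidableEq W] [Algebra ℝ A] (x : G.edgeSet → A) :
    MvPolynomial.aeval x (spanningTreePolynomial G) = (reducedLaplacian (edgeWeight G x)).det := by
  classical
  rw [aeval_spanningTreePolynomial_eq_sum, det_reducedLaplacian]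
  congr!

end SpanningTrees

section SeriesParallel

open Matrix

variable {W : Type*} [DecidableEq W] {p : W → Option W} {R : Type*} [CommRing R]

/-- The edge weights of the tree with parent map `p` in which the edge from `v` to its parent has
weight `x v`, and `v` is joined to the root `none` by a further edge of weight `t v`. -/
def groundedTreeWeight (p : W → Option W) (x t : W → R) (v : W) : Option W → R
  | none => (if p v = none then x v else 0) + t v
  | some u => (if p v = some u then x v else 0) + (if p u = some v then x u else 0)

variable [Fintype W]

theorem reducedLaplacian_groundedTreeWeight (x t : W → R) :
    reducedLaplacian (groundedTreeWeight p x t) =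
      diagonal (fun v => x v + t v + ∑ u with p u = some v, x u) -
        (parentMatrix p x)ᵀ - parentMatrix p x := by
  have sum_weight (v : W) : ∑ o, groundedTreeWeight p x t v o =
      x v + t v + ∑ u with p u = some v, x u := by
    have sum_parent : ∑ o, (if p v = o then x v else 0) = x v := by simp
    rw [Fintype.sum_option] at sum_parent ⊢
    simp only [groundedTreeWeight, Finset.sum_add_distrib, Finset.sum_filter]
    linear_combination sum_parent
  ext v u
  rw [reducedLaplacian, funext sum_weight]
  simp only [Matrix.sub_apply, transpose_apply, of_apply, groundedTreeWeight, parentMatrix]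
  ring

theorem parentMatrix_transpose_mul_parentMatrix (a b : W → R) :
    (parentMatrix p a)ᵀ * parentMatrix p b =
      diagonal fun v => ∑ u with p u = some v, a u * b u := by
  ext v u
  simp only [mul_apply, transpose_apply, parentMatrix, of_apply, diagonal_apply, Finset.sum_filter]
  split_ifs with h
  · subst h
    exact Finset.sum_congr rfl fun _ _ => by split_ifs <;> simp
  · refine Finset.sum_eq_zero fun i _ => ?_
    by_cases hi : p i = some v <;> simp [hi, h]

/-- If `c v` is the effective conductance between `v` and the root `none` through the part of the
network below `v`, as computed by the series and parallel laws, then Gaussian elimination from the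
leaves of the tree upwards has the pivots `x v + c v`. -/
theorem det_reducedLaplacian_groundedTreeWeight {K : Type*} [Field K] {x t c : W → K}
    (hp : IsRootedTree p) (hxc : ∀ v, p v ≠ none → x v + c v ≠ 0)
    (hc : ∀ v, c v = t v + ∑ u with p u = some v, x u * c u / (x u + c u)) :
    (reducedLaplacian (groundedTreeWeight p x t)).det = ∏ v, (x v + c v) := by
  set D : Matrix W W K := diagonal fun v => x v + c v with hD
  set N := parentMatrix p fun v => x v / (x v + c v) with hN
  have D_mul_N : D * N = parentMatrix p x := by
    ext v u
    rw [hD, diagonal_mul, hN]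
    simp only [parentMatrix, of_apply]
    split_ifs with h
    · exact mul_div_cancel₀ _ (hxc v (by simp [h]))
    · exact mul_zero _
  have factorization :
      reducedLaplacian (groundedTreeWeight p x t) = (1 - N)ᵀ * D * (1 - N) := by
    have diag_eq : diagonal (fun v => x v + t v + ∑ u with p u = some v, x u) =
        D + Nᵀ * parentMatrix p x := by
      rw [hN, parentMatrix_transpose_mul_parentMatrix, hD, diagonal_add]
      congr 1
      funext v
      rw [hc v, ← add_assoc, add_assoc (x v + t v), ← Finset.sum_add_distrib]
      congr 1
      refine Finset.sum_congr rfl fun u hu => ?_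
      have := hxc u (by simp [(Finset.mem_filter.1 hu).2])
      field_simp
      ring
    have N_mul_D : Nᵀ * D = (parentMatrix p x)ᵀ := by
      rw [← D_mul_N, transpose_mul, hD, diagonal_transpose]
    rw [reducedLaplacian_groundedTreeWeight, diag_eq, ← N_mul_D, ← D_mul_N]
    simp only [transpose_sub, transpose_one]
    noncomm_ring
  have det_one_sub_N : (1 - N).det = 1 := det_one_sub_parentMatrix_of_isRootedTree hp _
  rw [factorization, det_mul, det_mul, det_transpose, det_one_sub_N, hD, det_diagonal, one_mul,
    mul_one]

end SeriesParallel

section ElementarySymmetric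

open MvPolynomial

variable {n : ℕ}

theorem esymmOn_univ (j : ℕ) : esymmOn j (Finset.univ : Finset (Fin n)) = esymm (Fin n) ℝ j := rfl

theorem isHomogeneous_esymmOn (j : ℕ) (S : Finset (Fin n)) : (esymmOn j S).IsHomogeneous j := by
  refine IsHomogeneous.sum _ _ _ fun T hT => ?_
  simpa [(Finset.mem_powersetCard.1 hT).2] using
    IsHomogeneous.prod T (X : Fin n → MvPolynomial (Fin n) ℝ) (fun _ => 1)
      fun i _ => isHomogeneous_X ℝ i

theorem esymmOn_ne_zero {j : ℕ} {S : Finset (Fin n)} (h : j ≤ S.card) : esymmOn j S ≠ 0 := by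
  have eval_one : eval (fun _ => (1 : ℝ)) (esymmOn j S) = S.card.choose j := by simp [esymmOn]
  intro h0
  rw [h0, map_zero] at eval_one
  exact (Nat.choose_pos h).ne' (mod_cast eval_one.symm)

theorem esymmOn_insert (m : ℕ) {S : Finset (Fin n)} {a : Fin n} (ha : a ∉ S) :
    esymmOn (m + 1) (insert a S) = esymmOn (m + 1) S + X a * esymmOn m S := by
  have notMem {j : ℕ} : ∀ T ∈ S.powersetCard j, a ∉ T := fun T hT h =>
    ha ((Finset.mem_powersetCard.1 hT).1 h)
  have disjoint : Disjoint (S.powersetCard (m + 1)) ((S.powersetCard m).image (insert a)) := by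
    rw [Finset.disjoint_right]
    rintro _ hT hT'
    obtain ⟨T, -, rfl⟩ := Finset.mem_image.1 hT
    exact notMem _ hT' (Finset.mem_insert_self a T)
  have insert_injOn : Set.InjOn (insert a) (S.powersetCard m : Set (Finset (Fin n))) := by
    intro T hT T' hT' h
    rw [← Finset.erase_insert (notMem T hT), h, Finset.erase_insert (notMem T' hT')]
  rw [esymmOn, Finset.powersetCard_succ_insert ha, Finset.sum_union disjoint,
    Finset.sum_image insert_injOn, esymmOn, esymmOn, Finset.mul_sum]
  exact congrArg _ (Finset.sum_congr rfl fun T hT => Finset.prod_insert (notMem T hT))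

theorem pderiv_esymmOn_of_notMem (j : ℕ) {S : Finset (Fin n)} {a : Fin n} (ha : a ∉ S) :
    pderiv a (esymmOn j S) = 0 := by
  rw [esymmOn, map_sum]
  refine Finset.sum_eq_zero fun T hT => pderiv_eq_zero_of_notMem_vars fun h => ?_
  obtain ⟨i, hi, hai⟩ := Finset.mem_biUnion.1 (vars_prod _ h)
  rw [vars_X, Finset.mem_singleton] at hai
  exact ha (hai ▸ (Finset.mem_powersetCard.1 hT).1 hi)

theorem pderiv_esymmOn_insert (m : ℕ) {S : Finset (Fin n)} {a : Fin n} (ha : a ∉ S) :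
    pderiv a (esymmOn (m + 1) (insert a S)) = esymmOn m S := by
  rw [esymmOn_insert m ha, map_add, Derivation.leibniz, pderiv_esymmOn_of_notMem _ ha,
    pderiv_esymmOn_of_notMem _ ha, pderiv_X_self]
  simp

theorem partialSet_empty : partialSet (∅ : Finset (Fin n)) = 1 := Finset.noncommProd_empty _ _

theorem partialSet_insert {S : Finset (Fin n)} {a : Fin n} (ha : a ∉ S)
    (f : MvPolynomial (Fin n) ℝ) : partialSet (insert a S) f = pderiv a (partialSet S f) :=
  LinearMap.congr_fun (Finset.noncommProd_insert_of_notMem _ _ _ _ ha) f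

theorem compl_eq_insert_compl_insert {S : Finset (Fin n)} {a : Fin n} (ha : a ∉ S) :
    Sᶜ = insert a (insert a S)ᶜ := by
  rw [Finset.compl_insert, Finset.insert_erase (Finset.mem_compl.2 ha)]

theorem partialSet_esymm {r : ℕ} {S : Finset (Fin n)} (hS : S.card ≤ r) :
    partialSet S (esymm (Fin n) ℝ r) = esymmOn (r - S.card) Sᶜ := by
  induction S using Finset.induction_on with
  | empty => simp [partialSet_empty, esymmOn_univ]
  | insert a S ha ih =>
    rw [Finset.card_insert_of_notMem ha] at hS ⊢
    rw [partialSet_insert ha, ih (by lia), compl_eq_insert_compl_insert ha,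
      show r - S.card = r - (S.card + 1) + 1 by lia, pderiv_esymmOn_insert _ (by simp)]

theorem partialSet_esymm_eq_add {r : ℕ} {S : Finset (Fin n)} {a : Fin n} (ha : a ∉ S)
    (hS : S.card < r) :
    partialSet S (esymm (Fin n) ℝ r) = partialSet (insert a S) (esymm (Fin n) ℝ (r + 1)) +
      X a * partialSet (insert a S) (esymm (Fin n) ℝ r) := by
  have hcard := Finset.card_insert_of_notMem ha
  rw [partialSet_esymm hS.le, partialSet_esymm (by lia), partialSet_esymm (by lia), hcard,
    compl_eq_insert_compl_insert ha, show r - S.card = r - (S.card + 1) + 1 by lia,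
    esymmOn_insert _ (by simp), show r + 1 - (S.card + 1) = r - (S.card + 1) + 1 by lia]

theorem sum_X_mul_partialSet_insert_esymm {r : ℕ} {S : Finset (Fin n)} (hS : S.card ≤ r) :
    ∑ a ∈ Sᶜ, X a * partialSet (insert a S) (esymm (Fin n) ℝ r) =
      (r - S.card : ℕ) * partialSet S (esymm (Fin n) ℝ r) := by
  rw [← nsmul_eq_mul, partialSet_esymm hS, ← (isHomogeneous_esymmOn _ Sᶜ).sum_X_mul_pderiv,
    ← partialSet_esymm hS]
  refine Finset.sum_subset_zero_on_sdiff (Finset.subset_univ _) (fun a ha => ?_) fun a ha => ?_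
  · rw [partialSet_esymm hS, pderiv_esymmOn_of_notMem _ (Finset.mem_sdiff.1 ha).2, mul_zero]
  · rw [partialSet_insert (Finset.mem_compl.1 ha)]

end ElementarySymmetric

section Words

variable {n k : ℕ}

/-- The parent of a word in the tree `G_{n,k} ∖ {z}`: the last letter is removed. As in
`IsRootedTree`, the value at the top of the tree, the empty word `s`, is `none`, which is `z`. -/
def parentWord (v : DWord n k) : Option (DWord n k) :=
  if v.1 = [] then none
  else some ⟨v.1.dropLast, v.2.1.sublist (List.dropLast_sublist _),
    (List.dropLast_sublist _).length_le.trans v.2.2⟩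

theorem parentWord_eq_none_iff {v : DWord n k} : parentWord v = none ↔ v.1 = [] := by
  simp [parentWord]

theorem parentWord_eq_some_iff {u v : DWord n k} :
    parentWord v = some u ↔ ∃ a, v.1 = u.1 ++ [a] := by
  rcases List.eq_nil_or_concat v.1 with h | ⟨w, a, h⟩
  · simp [parentWord, h]
  · rw [List.concat_eq_append] at h
    simp only [parentWord, h, List.append_eq_nil_iff, List.cons_ne_self, and_false, if_false,
      List.dropLast_concat, Option.some.injEq, Subtype.ext_iff]
    constructor
    · rintro rfl
      exact ⟨a, rfl⟩
    · rintro ⟨b, hb⟩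
      exact List.append_inj_left' hb rfl

theorem length_of_parentWord_eq_some {u v : DWord n k} (h : parentWord v = some u) :
    v.1.length = u.1.length + 1 := by
  obtain ⟨a, ha⟩ := parentWord_eq_some_iff.1 h
  simp [ha]

theorem isRootedTree_parentWord : IsRootedTree (parentWord : DWord n k → _) :=
  Subrelation.wf (fun h => Nat.lt_of_succ_le (length_of_parentWord_eq_some h).ge)
    (measure fun v : DWord n k => v.1.length).wf

theorem card_toFinset_word (v : DWord n k) : v.1.toFinset.card = v.1.length :=
  List.toFinset_card_of_nodup v.2.1

theorem sum_children {M : Type*} [AddCommMonoid M] (f : List (Fin n) → M) {u : DWord n k}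
    (hu : u.1.length < k) :
    ∑ v with parentWord v = some u, f v.1 = ∑ a ∈ u.1.toFinsetᶜ, f (u.1 ++ [a]) := by
  have nodup_append {a : Fin n} : (u.1 ++ [a]).Nodup ↔ a ∈ u.1.toFinsetᶜ := by
    simp [List.nodup_append, u.2.1, List.forall_mem_ne']
  symm
  refine Finset.sum_bij (fun a ha => ⟨u.1 ++ [a], nodup_append.2 ha, by simpa using hu⟩) ?_ ?_ ?_
    fun _ _ => rfl
  · exact fun a _ => (Finset.mem_filter_univ _).2 (parentWord_eq_some_iff.2 ⟨a, rfl⟩)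
  · exact fun a _ b _ h => by simpa using congrArg Subtype.val h
  · intro v hv
    obtain ⟨a, ha⟩ := parentWord_eq_some_iff.1 (Finset.mem_filter.1 hv).2
    exact ⟨a, nodup_append.1 (ha ▸ v.2.1), Subtype.ext ha.symm⟩

theorem children_eq_empty {u : DWord n k} (hu : u.1.length = k) :
    ({v | parentWord v = some u} : Finset (DWord n k)) = ∅ := by
  refine Finset.filter_eq_empty_iff.2 fun v _ hv => ?_
  have := length_of_parentWord_eq_some hv
  have := v.2.2
  lia

theorem card_children {u : DWord n k} (hu : u.1.length < k) :
    Finset.card {v | parentWord v = some u} = n - u.1.length := by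
  rw [Finset.card_eq_sum_ones, sum_children (fun _ => 1) hu, ← Finset.card_eq_sum_ones,
    Finset.card_compl, Fintype.card_fin, card_toFinset_word]

theorem card_word_toFinset_eq {S : Finset (Fin n)} (hS : S.card ≤ k) :
    Finset.card {u : DWord n k | u.1.toFinset = S} = S.card ! := by
  rw [← Finset.length_toList S, ← List.length_permutations,
    ← List.toFinset_card_of_nodup (List.nodup_permutations _ S.nodup_toList)]
  refine Finset.card_bij (fun u _ => u.1) ?_ (fun u _ v _ h => Subtype.ext h) ?_
  · intro u hu
    rw [List.mem_toFinset, List.mem_permutations, List.perm_ext_iff_of_nodup u.2.1 S.nodup_toList]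
    intro a
    rw [Finset.mem_toList, ← (Finset.mem_filter_univ _).1 hu, List.mem_toFinset]
  · intro l hl
    rw [List.mem_toFinset, List.mem_permutations] at hl
    refine ⟨⟨l, hl.nodup_iff.2 S.nodup_toList, ?_⟩, ?_, rfl⟩
    · rwa [hl.length_eq, Finset.length_toList]
    · rw [Finset.mem_filter_univ, List.toFinset_eq_of_perm _ _ hl, Finset.toList_toFinset]

theorem prod_word_toFinset {M : Type*} [CommMonoid M] {P : ℕ → Prop} [DecidablePred P]
    (hP : ∀ l, P l → l ≤ k) (g : Finset (Fin n) → M) :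
    ∏ u : DWord n k with P u.1.length, g u.1.toFinset =
      ∏ S : Finset (Fin n) with P S.card, g S ^ S.card ! := by
  have toFinset_mem : ∀ u ∈ ({u | P u.1.length} : Finset (DWord n k)),
      u.1.toFinset ∈ ({S | P S.card} : Finset (Finset (Fin n))) := fun u hu => by
    simpa [card_toFinset_word] using hu
  rw [← Finset.prod_fiberwise_of_maps_to' toFinset_mem]
  refine Finset.prod_congr rfl fun S hS => ?_
  have hPS : P S.card := (Finset.mem_filter.1 hS).2
  have fiber_eq : ({u | P u.1.length} : Finset (DWord n k)).filter (fun u => u.1.toFinset = S) =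
      ({u | u.1.toFinset = S} : Finset (DWord n k)) := by
    rw [Finset.filter_filter]
    refine Finset.filter_congr fun u _ => and_iff_right_of_imp fun h => ?_
    rwa [← card_toFinset_word, h]
  rw [Finset.prod_const, fiber_eq, card_word_toFinset_eq (hP _ hPS)]

theorem prod_elim_eq_pow_card {V M : Type*} [Fintype V] [DecidableEq V] [CommMonoid M]
    (p : V → Option V) (b : M) (F : V → M) :
    ∏ v, (p v).elim b F =
      b ^ Finset.card {v | p v = none} * ∏ u, F u ^ Finset.card {v | p v = some u} := by
  rw [← Finset.prod_fiberwise' Finset.univ p fun o => o.elim b F, Fintype.prod_option]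
  simp

theorem prod_parentWord_elim_div {K : Type*} [Field K] (hkn : k ≤ n) (b : K)
    {E : Finset (Fin n) → K} (hE : ∀ S : Finset (Fin n), S.card ≤ k → E S ≠ 0) :
    ∏ v : DWord n k, ((parentWord v).elim b (fun u => E u.1.toFinset) / E v.1.toFinset) =
      b * (∏ S with S.card < k, E S ^ (S.card ! * (n - S.card - 1))) /
        ∏ S with S.card = k, E S ^ k ! := by
  have card_root : Finset.card {v : DWord n k | parentWord v = none} = 1 :=
    Finset.card_eq_one.2 ⟨⟨[], by simp⟩, by ext; simp [parentWord_eq_none_iff, Subtype.ext_iff]⟩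
  have factor_eq (u : DWord n k) :
      E u.1.toFinset ^ Finset.card {v | parentWord v = some u} / E u.1.toFinset =
        (if u.1.length < k then E u.1.toFinset ^ (n - u.1.toFinset.card - 1) else 1) *
          if u.1.length = k then (E u.1.toFinset)⁻¹ else 1 := by
    have hEu : E u.1.toFinset ≠ 0 := hE _ ((card_toFinset_word u).trans_le u.2.2)
    rcases u.2.2.lt_or_eq with hu | hu
    · rw [card_children hu, if_pos hu, if_neg hu.ne, mul_one, card_toFinset_word,
        div_eq_iff hEu, pow_sub_one_mul (by lia)]
    · rw [children_eq_empty hu, if_neg hu.not_lt, if_pos hu, Finset.card_empty, pow_zero, one_mul,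
        one_div]
  rw [Finset.prod_div_distrib, prod_elim_eq_pow_card, card_root, pow_one, mul_div_assoc,
    ← Finset.prod_div_distrib, Finset.prod_congr rfl fun u _ => factor_eq u,
    Finset.prod_mul_distrib, ← Finset.prod_filter, ← Finset.prod_filter,
    prod_word_toFinset (P := (· < k)) (fun _ => le_of_lt) fun S => E S ^ (n - S.card - 1),
    prod_word_toFinset (P := (· = k)) (fun _ => le_of_eq) fun S => (E S)⁻¹]
  have prod_inv : ∏ S : Finset (Fin n) with S.card = k, (E S)⁻¹ ^ S.card ! =
      (∏ S : Finset (Fin n) with S.card = k, E S ^ k !)⁻¹ := by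
    rw [← Finset.prod_inv_distrib]
    exact Finset.prod_congr rfl fun S hS => by rw [inv_pow, (Finset.mem_filter.1 hS).2]
  simp only [← pow_mul', prod_inv, mul_assoc, div_eq_mul_inv]

end Words

noncomputable section Evaluation

open MvPolynomial

variable {n k r : ℕ}

/-- The derivative `∂^S e_r`, as a rational function. -/
def esymmDeriv (r : ℕ) (S : Finset (Fin n)) : RatFun n :=
  algebraMap (MvPolynomial (Fin n) ℝ) (RatFun n) (partialSet S (esymm (Fin n) ℝ r))

theorem esymmDeriv_ne_zero (hrn : r ≤ n) {S : Finset (Fin n)} (hS : S.card ≤ r) :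
    esymmDeriv r S ≠ 0 := by
  rw [esymmDeriv, partialSet_esymm hS, Ne, FaithfulSMul.algebraMap_eq_zero_iff]
  exact esymmOn_ne_zero (by rw [Finset.card_compl, Fintype.card_fin]; lia)

theorem esymmDeriv_eq_add {S : Finset (Fin n)} {a : Fin n} (ha : a ∉ S) (hS : S.card < r) :
    esymmDeriv r S = esymmDeriv (r + 1) (insert a S) +
      algebraMap (MvPolynomial (Fin n) ℝ) (RatFun n) (X a) * esymmDeriv r (insert a S) := by
  simp only [esymmDeriv, partialSet_esymm_eq_add ha hS, map_add, map_mul]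

theorem sum_X_mul_esymmDeriv_insert {S : Finset (Fin n)} (hS : S.card ≤ r) :
    ∑ a ∈ Sᶜ, algebraMap (MvPolynomial (Fin n) ℝ) (RatFun n) (X a) * esymmDeriv r (insert a S) =
      (r - S.card : ℕ) * esymmDeriv r S := by
  simp only [esymmDeriv, ← map_mul, ← map_sum, sum_X_mul_partialSet_insert_esymm hS]
  rw [map_mul, map_natCast]

/-- The effective conductance `(r - |v| + 1)! q_{r-|v|+1}([n] ∖ v)` between the word `v` and `z`
through the words extending `v`. -/
def conductance (r : ℕ) (v : List (Fin n)) : RatFun n := terminalVar v.length r v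

theorem conductance_eq {v : List (Fin n)} (hv : v.Nodup) (hvr : v.length ≤ r) :
    conductance r v = ((r - v.length + 1)! : RatFun n) *
      (esymmDeriv (r + 1) v.toFinset / esymmDeriv r v.toFinset) := by
  have hcard : v.toFinset.card = v.length := List.toFinset_card_of_nodup hv
  rw [esymmDeriv, esymmDeriv, partialSet_esymm (by lia), partialSet_esymm (by lia), hcard,
    show r + 1 - v.length = r - v.length + 1 by lia]
  rfl

theorem letterVar_append {u : List (Fin n)} (hur : u.length < r) (a : Fin n) :
    letterVar r (u ++ [a]) = ((r - u.length)! : RatFun n) *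
      algebraMap (MvPolynomial (Fin n) ℝ) (RatFun n) (X a) := by
  simp [letterVar, show r - (u.length + 1) + 1 = r - u.length by lia]

theorem toFinset_append_singleton (u : List (Fin n)) (a : Fin n) :
    (u ++ [a]).toFinset = insert a u.toFinset := by
  ext
  simp

theorem conductance_append {u : List (Fin n)} (hu : u.Nodup) (hur : u.length < r) {a : Fin n}
    (ha : a ∉ u) :
    conductance r (u ++ [a]) = ((r - u.length)! : RatFun n) *
      (esymmDeriv (r + 1) (insert a u.toFinset) / esymmDeriv r (insert a u.toFinset)) := by
  have hlen : (u ++ [a]).length = u.length + 1 := by simp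
  rw [conductance_eq (List.concat_eq_append ▸ hu.concat ha) (by lia), hlen,
    toFinset_append_singleton, show r - (u.length + 1) + 1 = r - u.length by lia]

theorem esymmDeriv_insert_ne_zero (hrn : r ≤ n) {u : List (Fin n)} (hur : u.length < r)
    (a : Fin n) : esymmDeriv r (insert a u.toFinset) ≠ 0 := by
  refine esymmDeriv_ne_zero hrn ((Finset.card_insert_le _ _).trans ?_)
  exact (Nat.succ_le_succ (List.toFinset_card_le u)).trans hur

theorem letterVar_append_add_conductance (hrn : r ≤ n) {u : List (Fin n)} (hu : u.Nodup)
    (hur : u.length < r) {a : Fin n} (ha : a ∉ u) :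
    letterVar r (u ++ [a]) + conductance r (u ++ [a]) = ((r - u.length)! : RatFun n) *
      (esymmDeriv r u.toFinset / esymmDeriv r (insert a u.toFinset)) := by
  have hne := esymmDeriv_insert_ne_zero hrn hur a
  rw [letterVar_append hur, conductance_append hu hur ha,
    esymmDeriv_eq_add (mt List.mem_toFinset.1 ha) (u.toFinset_card_le.trans_lt hur)]
  field_simp
  ring

theorem letterVar_append_mul_conductance_div (hrn : r ≤ n) {u : List (Fin n)} (hu : u.Nodup)
    (hur : u.length < r) {a : Fin n} (ha : a ∉ u) :
    letterVar r (u ++ [a]) * conductance r (u ++ [a]) /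
        (letterVar r (u ++ [a]) + conductance r (u ++ [a])) =
      ((r - u.length)! : RatFun n) / esymmDeriv r u.toFinset *
        (algebraMap (MvPolynomial (Fin n) ℝ) (RatFun n) (X a) *
          esymmDeriv (r + 1) (insert a u.toFinset)) := by
  have hne := esymmDeriv_insert_ne_zero hrn hur a
  have hne' : esymmDeriv r u.toFinset ≠ 0 :=
    esymmDeriv_ne_zero hrn (u.toFinset_card_le.trans hur.le)
  have hfac : ((r - u.length)! : RatFun n) ≠ 0 := Nat.cast_ne_zero.2 (Nat.factorial_ne_zero _)
  rw [letterVar_append_add_conductance hrn hu hur ha, letterVar_append hur,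
    conductance_append hu hur ha]
  field_simp

theorem conductance_eq_sum {u : List (Fin n)} (hrn : r ≤ n) (hu : u.Nodup) (hur : u.length < r) :
    conductance r u = ∑ a ∈ u.toFinsetᶜ, letterVar r (u ++ [a]) * conductance r (u ++ [a]) /
      (letterVar r (u ++ [a]) + conductance r (u ++ [a])) := by
  have hcard : u.toFinset.card = u.length := List.toFinset_card_of_nodup hu
  have summand_eq {a : Fin n} (ha : a ∈ u.toFinsetᶜ) :=
    letterVar_append_mul_conductance_div hrn hu hur
      (mt List.mem_toFinset.2 (Finset.mem_compl.1 ha))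
  rw [Finset.sum_congr rfl fun a ha => summand_eq ha, ← Finset.mul_sum,
    sum_X_mul_esymmDeriv_insert (by lia), conductance_eq hu hur.le, hcard,
    show r + 1 - u.length = r - u.length + 1 by lia, Nat.factorial_succ, Nat.cast_mul]
  ring

theorem conductance_eq_add_sum_children (hkr : k ≤ r) (hrn : r ≤ n) (u : DWord n k) :
    conductance r u.1 = (if u.1.length = k then terminalVar k r u.1 else 0) +
      ∑ v with parentWord v = some u,
        letterVar r v.1 * conductance r v.1 / (letterVar r v.1 + conductance r v.1) := by
  rcases u.2.2.lt_or_eq with hu | hu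
  · rw [if_neg hu.ne, zero_add, conductance_eq_sum hrn u.2.1 (hu.trans_le hkr), sum_children
      (fun v => letterVar r v * conductance r v / (letterVar r v + conductance r v)) hu]
  · rw [if_pos hu, children_eq_empty hu, Finset.sum_empty, add_zero, conductance, hu]

theorem letterVar_add_conductance (hkr : k ≤ r) (hrn : r ≤ n) (v : DWord n k) :
    letterVar r v.1 + conductance r v.1 = ((r - v.1.length + 1)! : RatFun n) *
      ((parentWord v).elim (esymmDeriv (r + 1) ∅) (fun u => esymmDeriv r u.1.toFinset) /
        esymmDeriv r v.1.toFinset) := by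
  rcases hv : parentWord v with _ | u
  · rw [conductance_eq v.2.1 (v.2.2.trans hkr)]
    simp [letterVar, parentWord_eq_none_iff.1 hv]
  · have hlen := length_of_parentWord_eq_some hv
    have hvk := v.2.2
    obtain ⟨a, ha⟩ := parentWord_eq_some_iff.1 hv
    have hau : a ∉ u.1 := ((List.nodup_concat u.1 a).1 (by simpa [← ha] using v.2.1)).1
    rw [Option.elim_some, hlen, ha, letterVar_append_add_conductance hrn u.2.1 (by lia) hau,
      toFinset_append_singleton, show r - (u.1.length + 1) + 1 = r - u.1.length by lia]

theorem letterVar_add_conductance_ne_zero (hkr : k ≤ r) (hrn : r ≤ n) {v : DWord n k}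
    (hv : parentWord v ≠ none) : letterVar r v.1 + conductance r v.1 ≠ 0 := by
  have esymmDeriv_word_ne_zero (u : DWord n k) : esymmDeriv r u.1.toFinset ≠ 0 :=
    esymmDeriv_ne_zero hrn ((card_toFinset_word u).trans_le (u.2.2.trans hkr))
  obtain ⟨u, hu⟩ := Option.ne_none_iff_exists'.1 hv
  rw [letterVar_add_conductance hkr hrn, hu]
  exact mul_ne_zero (Nat.cast_ne_zero.2 (Nat.factorial_ne_zero _))
    (div_ne_zero (esymmDeriv_word_ne_zero u) (esymmDeriv_word_ne_zero v))

theorem edgeWeight_edgeValue : edgeWeight (GGraph n k) (edgeValue n k r) =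
    groundedTreeWeight parentWord (fun v => letterVar r v.1)
      fun v => if v.1.length = k then terminalVar k r v.1 else 0 := by
  have adj_iff {u v : DWord n k} :
      (GGraph n k).Adj (some v) (some u) ↔ parentWord u = some v ∨ parentWord v = some u := by
    rw [parentWord_eq_some_iff, parentWord_eq_some_iff]
    rfl
  classical
  have edgeWeight_eq (v : DWord n k) (o : GVertex n k) :
      edgeWeight (GGraph n k) (edgeValue n k r) v o =
        if (GGraph n k).Adj (some v) o then endpointVar n k r (some v) o else 0 := by
    rw [edgeWeight, ← dite_eq_ite]
    congr
  funext v o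
  rw [edgeWeight_eq]
  rcases o with _ | u
  · have letterVar_top : (if parentWord v = none then letterVar r v.1 else 0) = 0 :=
      ite_eq_right_iff.2 fun h => by simp [parentWord_eq_none_iff.1 h, letterVar]
    rw [groundedTreeWeight, letterVar_top, zero_add]
    exact if_congr Iff.rfl rfl rfl
  · rw [groundedTreeWeight, if_congr adj_iff rfl rfl, endpointVar]
    by_cases huv : parentWord v = some u
    · have hlen := length_of_parentWord_eq_some huv
      have hvu : parentWord u ≠ some v := isRootedTree_parentWord.asymmetric u v huv
      simp [huv, hvu, hlen]
    · by_cases hvu : parentWord u = some v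
      · have hlen := length_of_parentWord_eq_some hvu
        simp [huv, hvu, hlen]
      · simp [huv, hvu]

theorem HRat_eq_prod (hkr : k ≤ r) (hrn : r ≤ n) :
    HRat n k r = ∏ v : DWord n k, (letterVar r v.1 + conductance r v.1) := by
  rw [HRat, aeval_spanningTreePolynomial_eq_det, edgeWeight_edgeValue]
  exact det_reducedLaplacian_groundedTreeWeight isRootedTree_parentWord
    (fun _ => letterVar_add_conductance_ne_zero hkr hrn) (conductance_eq_add_sum_children hkr hrn)

end Evaluation

section LinearForms

open MvPolynomial

variable {n k : ℕ}

/-- The linear forms in `x_1, …, x_n`, including `0`, as rational functions. -/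
noncomputable def linearForms (n : ℕ) : Submodule ℝ (RatFun n) :=
  (homogeneousSubmodule (Fin n) ℝ 1).map
    (IsScalarTower.toAlgHom ℝ (MvPolynomial (Fin n) ℝ) (RatFun n)).toLinearMap

theorem algebraMap_mem_linearForms {p : MvPolynomial (Fin n) ℝ} (hp : p.IsHomogeneous 1) :
    algebraMap (MvPolynomial (Fin n) ℝ) (RatFun n) p ∈ linearForms n :=
  Submodule.mem_map_of_mem hp

theorem natCast_mul_mem_linearForms (m : ℕ) {q : RatFun n} (hq : q ∈ linearForms n) :
    (m : RatFun n) * q ∈ linearForms n :=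
  nsmul_eq_mul m q ▸ (linearForms n).smul_of_tower_mem m hq

theorem letterVar_mem_linearForms (r : ℕ) (w : List (Fin n)) : letterVar r w ∈ linearForms n := by
  rw [letterVar]
  split
  · exact zero_mem _
  · exact natCast_mul_mem_linearForms _ (algebraMap_mem_linearForms (isHomogeneous_X ℝ _))

theorem terminalVar_self_mem_linearForms (k : ℕ) (w : List (Fin n)) :
    terminalVar k k w ∈ linearForms n := by
  have qRat_one (S : Finset (Fin n)) :
      qRat 1 S = algebraMap (MvPolynomial (Fin n) ℝ) (RatFun n) (esymmOn 1 S) := by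
    simp [qRat, esymmOn]
  rw [terminalVar, Nat.sub_self, zero_add, qRat_one]
  exact natCast_mul_mem_linearForms _ (algebraMap_mem_linearForms (isHomogeneous_esymmOn 1 _))

theorem edgeValue_self_mem_linearForms (e : (GGraph n k).edgeSet) :
    edgeValue n k k e ∈ linearForms n := by
  obtain ⟨⟨u, v⟩, he⟩ := e
  change endpointVar n k k u v ∈ linearForms n
  rcases u with _ | u <;> rcases v with _ | v <;> simp only [endpointVar]
  · exact zero_mem _
  · exact terminalVar_self_mem_linearForms k _
  · exact terminalVar_self_mem_linearForms k _
  · split_ifs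
    exacts [letterVar_mem_linearForms k _, letterVar_mem_linearForms k _, zero_mem _]

theorem exists_linear_substitution (n k : ℕ) :
    ∃ L : (GGraph n k).edgeSet → MvPolynomial (Fin n) ℝ,
      (∀ e, (L e).IsHomogeneous 1 ∧
        algebraMap (MvPolynomial (Fin n) ℝ) (RatFun n) (L e) = edgeValue n k k e) ∧
      HRat n k k = algebraMap (MvPolynomial (Fin n) ℝ) (RatFun n)
        (aeval L (spanningTreePolynomial (GGraph n k))) := by
  choose L hL using edgeValue_self_mem_linearForms (n := n) (k := k)
  refine ⟨L, hL, ?_⟩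
  rw [HRat, ← aeval_algebraMap_apply]
  exact congrArg (aeval · _) (funext fun e => (hL e).2.symm)

end LinearForms

open MvPolynomial in
theorem lemma2_general (n k r : ℕ) (hkr : k ≤ r) (hrn : r ≤ n) :
    HRat n k r = algebraMap (MvPolynomial (Fin n) ℝ) (RatFun n)
        (C (∏ v : DWord n k, ((r - v.1.length + 1)! : ℝ)) * esymm (Fin n) ℝ (r + 1) *
          ∏ S : Finset (Fin n) with S.card < k,
            (partialSet S (esymm (Fin n) ℝ r)) ^ (S.card ! * (n - S.card - 1))) /
      algebraMap (MvPolynomial (Fin n) ℝ) (RatFun n)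
        (∏ S : Finset (Fin n) with S.card = k, (partialSet S (esymm (Fin n) ℝ r)) ^ k !) := by
  rw [HRat_eq_prod hkr hrn, Finset.prod_congr rfl fun v _ => letterVar_add_conductance hkr hrn v,
    Finset.prod_mul_distrib, prod_parentWord_elim_div (hkr.trans hrn) _
      fun S hS => esymmDeriv_ne_zero hrn (hS.trans hkr)]
  simp only [map_mul, map_prod, map_pow, map_natCast, esymmDeriv, partialSet_empty,
    Module.End.one_apply, mul_assoc, mul_div_assoc]

theorem lemma2 (n k : ℕ) (hk : 1 ≤ k) (hkn : k ≤ n - 1) :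
    (∃ L : (GGraph n k).edgeSet → MvPolynomial (Fin n) ℝ,
      (∀ e, (L e).IsHomogeneous 1 ∧
        algebraMap (MvPolynomial (Fin n) ℝ) (RatFun n) (L e) = edgeValue n k k e) ∧
      HRat n k k = algebraMap (MvPolynomial (Fin n) ℝ) (RatFun n)
        (MvPolynomial.aeval L (spanningTreePolynomial (GGraph n k)))) ∧
    ∃ C : ℝ, 0 < C ∧
      HRat n k k = algebraMap (MvPolynomial (Fin n) ℝ) (RatFun n)
        (MvPolynomial.C C * MvPolynomial.esymm (Fin n) ℝ (k + 1) *
          ∏ S : Finset (Fin n) with S.card ≤ k - 1,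
            (partialSet S (MvPolynomial.esymm (Fin n) ℝ k)) ^ (S.card ! * (n - S.card - 1))) := by
  have deriv_top_eq_one : ∏ S : Finset (Fin n) with S.card = k,
      (partialSet S (MvPolynomial.esymm (Fin n) ℝ k)) ^ k ! = 1 :=
    Finset.prod_eq_one fun S hS => by
      have hS : S.card = k := (Finset.mem_filter.1 hS).2
      simp [partialSet_esymm hS.le, hS, esymmOn]
  refine ⟨exists_linear_substitution n k, ∏ v : DWord n k, ((k - v.1.length + 1)! : ℝ),
    Finset.prod_pos fun v _ => Nat.cast_pos.2 (Nat.factorial_pos _), ?_⟩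
  rw [lemma2_general n k k le_rfl (by lia), deriv_top_eq_one, map_one, div_one]
  simp only [Nat.lt_iff_le_pred hk]
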